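/- Setting. Let $\mathcal H$ be a complex Hilbert space. A bounded operator $T$ on $\mathcal H$ is a near-isometry if there is $\delta>0$ with $\delta\|x\|\le\|Tx\|\le\|x\|$ for all $x\in\mathcal H$, and $T^{*m}T^{m+1}\mathcal H\subseteq T\mathcal H$ for all $m\ge 0$. Let $n\ge 2$ and $I_n=\{1,\dots,n\}$. A tuple $T=(T_1,\dots,T_n)$ of near-isometries on $\mathcal H$ is a doubly twisted near-isometry with respect to commuting unitaries $\{U_{ij}\}_{1\le i<j\le n}$ on $\mathcal H$ if for all $1\le i<j\le n$ and $1\le k\le n$ $$T_i^*T_j=U_{ij}^*T_jT_i^*,\qquad T_kU_{ij}=U_{ij}T_k,\qquad T_iT_j=U_{ij}T_jT_i .$$ For $A=\{a_1<\dots<a_m\}\subseteq I_n$ and $k\in\mathbb N_0^{m}$ put $T_A^{k}=T_{a_1}^{k_1}\cdots T_{a_m}^{k_m}$ (with $T_\emptyset^{k}=I$), $\mathcal W_A=\bigcap_{i\in A}\ker T_i^*$ (with $\mathcal W_\emptyset=\mathcal H$), and $$\mathcal D_A=\bigcap_{\ell\in\mathbb N_0^{n-m}}T_{I_n\setminus A}^{\ell}\,\mathcal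 W_A .$$ For a Hilbert space $\mathcal E$, $H^2_{\mathcal E}(\mathbb D^m)$ is the Hardy space of functions $f(z)=\sum_{k\in\mathbb N_0^m}z^k c_k$ on the polydisc with $c_k\in\mathcal E$ and $\|f\|^2=\sum_k\|c_k\|^2<\infty$; $z^k\otimes\eta$ denotes the function $z\mapsto z^k\eta$. For $m=0$ the space $H^2_{\mathcal E}(\mathbb D^0)$ is $\mathcal E$ itself. Theorem. Let $T=(T_1,\dots,T_n)$ be a doubly twisted near-isometry on $\mathcal H$. For every $A\subseteq I_n$ and $k\in\mathbb N_0^{|A|}$ let $\Lambda_{A,k}:\mathcal D_A\to T_A^k\mathcal D_A$ be the unitary factor of the polar decomposition $T_A^k|_{\mathcal D_A}=\Lambda_{A,k}P_{A,k}$, $P_{A,k}\ge 0$ on $\mathcal D_A$; these unitaries exist. Then for all $A=\{a_1<\dots<a_m\}\subseteq I_n$, $k\in\mathbb N_0^{m}$ and $\eta\in\mathcal D_A$ one has $T_{a_i}\Lambda_{A,k}\eta\in T_A^{k+e_i}\mathcal D_A$ for $1\le i\le m$ and $T_s\Lambda_{A,k}\eta\in T_A^{k}\mathcal D_A$ for $s\notin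 A$, and there are bounded operators $M_{A,s}$ $(A\subseteq I_n,\ 1\le s\le n)$ on $H^2_{\mathcal D_A}(\mathbb D^{|A|})$ with $$ M_{A,s}(z^{k}\otimes\eta)= \begin{cases} z^{k+e_i}\otimes\Lambda_{A,k+e_i}^*T_{a_i}\Lambda_{A,k}\,\eta & \text{if } s=a_i\in A,\\ z^{k}\otimes\Lambda_{A,k}^*T_{s}\Lambda_{A,k}\,\eta & \text{if } s\notin A, \end{cases} $$ for all $k\in\mathbb N_0^{|A|}$, $\eta\in\mathcal D_A$. With $M_{T,s}=\bigoplus_{A\subseteq I_n}M_{A,s}$, the tuple $T$ is unitarily equivalent to $(M_{T,1},\dots,M_{T,n})$, i.e. there is one unitary $V:\mathcal H\to\bigoplus_{A\subseteq I_n}H^2_{\mathcal D_A}(\mathbb D^{|A|})$ with $VT_sV^*=M_{T,s}$ for all $1\le s\le n$. -/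

import Mathlib

open scoped InnerProductSpace ENNReal

noncomputable section

/-! ### Vector-valued Hardy spaces over the polydisc -/

/-- The open unit polydisc `𝔻^ι` (a single point when `ι` is empty). -/
def Polydisc (ι : Type*) : Set (ι → ℂ) := {z | ∀ i, ‖z i‖ < 1}

/-- The monomial function `z ↦ z ^ k = ∏ i, z i ^ k i`. -/
def multiPow {ι : Type*} [Fintype ι] (k : ι → ℕ) (z : ι → ℂ) : ℂ := ∏ i, z i ^ k i

theorem integral_fourier_eq_zero {m : ℤ} (hm : m ≠ 0) :
    ∫ x : AddCircle (1 : ℝ), fourier m x ∂AddCircle.haarAddCircle = 0 :=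
  MeasureTheory.integral_eq_zero_of_add_right_eq_neg (μ := AddCircle.haarAddCircle)
    (fourier_add_half_inv_index hm one_pos)

theorem integral_prod_fourier {ι : Type*} [Fintype ι] [DecidableEq (ι → ℕ)] (k l : ι → ℕ) :
    ∫ x : ι → AddCircle (1 : ℝ), ∏ i, fourier ((k i : ℤ) - l i) (x i)
      ∂MeasureTheory.Measure.pi (fun _ => AddCircle.haarAddCircle) = if k = l then 1 else 0 := by
  rw [MeasureTheory.integral_fintype_prod_eq_prod (fun i x => fourier ((k i : ℤ) - l i) x)]
  split_ifs with hk
  · subst hk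
    simp
  · obtain ⟨i, hi⟩ := Function.ne_iff.mp hk
    exact Finset.prod_eq_zero (Finset.mem_univ i) (integral_fourier_eq_zero (by omega))

/-- A scalar power series that vanishes on the polydisc has zero coefficients. -/
theorem scalar_coeff_eq_zero {ι : Type*} [Fintype ι] (a : (ι → ℕ) → ℂ)
    (h : ∀ z ∈ Polydisc ι, HasSum (fun k => multiPow k z * a k) 0) (l : ι → ℕ) : a l = 0 := by
  classical
  obtain ⟨r, hr0, hr1⟩ : ∃ r : ℂ, r ≠ 0 ∧ ‖r‖ < 1 := ⟨1 / 2, by norm_num, by norm_num⟩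
  obtain ⟨w, hw⟩ : ∃ w : (ι → AddCircle (1 : ℝ)) → ι → ℂ, ∀ x i, w x i = r * fourier 1 (x i) :=
    ⟨_, fun _ _ => rfl⟩
  have hwD : ∀ x, w x ∈ Polydisc ι := by
    intro x i
    rw [hw, norm_mul, fourier_apply, Circle.norm_coe, mul_one]
    exact hr1
  have hwk : ∀ k x, multiPow k (w x) = (∏ i, r ^ k i) * ∏ i, fourier (k i : ℤ) (x i) := by
    intro k x
    rw [multiPow, ← Finset.prod_mul_distrib]
    refine Finset.prod_congr rfl fun i _ => ?_
    rw [hw, mul_pow]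
    congr 1
    simp [fourier_apply, AddCircle.toCircle_nsmul]
  obtain ⟨F, hF⟩ : ∃ F : (ι → ℕ) → (ι → AddCircle (1 : ℝ)) → ℂ, ∀ k x, F k x =
    ((∏ i, r ^ k i) * a k) * ∏ i, fourier ((k i : ℤ) - l i) (x i) := ⟨_, fun _ _ => rfl⟩
  have hFeq : ∀ k x, F k x = (∏ i, fourier (-(l i : ℤ)) (x i)) * (multiPow k (w x) * a k) := by
    intro k x
    simp only [hF, hwk, sub_eq_add_neg, fourier_add, Finset.prod_mul_distrib]
    ring
  have hnorm : ∀ k x, ‖F k x‖ = ‖(∏ i, r ^ k i) * a k‖ := by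
    intro k x
    simp only [hF, norm_mul, norm_prod, fourier_apply, Circle.norm_coe, Finset.prod_const_one,
      mul_one]
  have hsum0 : Summable fun k => ‖(∏ i, r ^ k i) * a k‖ := by
    have := (h (fun _ => r) (fun _ => hr1)).summable
    simpa only [multiPow] using this.norm
  have hcont : ∀ k, Continuous (F k) := by
    intro k
    rw [funext (hF k)]
    exact continuous_const.mul (continuous_finsetProd _ fun i _ =>
      (fourier ((k i : ℤ) - l i)).continuous.comp (continuous_apply i))
  have hint : ∀ k, MeasureTheory.Integrable (F k)
      (MeasureTheory.Measure.pi fun _ => AddCircle.haarAddCircle) := fun k =>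
    (MeasureTheory.integrable_const (‖(∏ i, r ^ k i) * a k‖)).mono'
      (hcont k).aestronglyMeasurable (Filter.Eventually.of_forall fun x => (hnorm k x).le)
  have hs := MeasureTheory.hasSum_integral_of_summable_integral_norm hint (by
    simpa only [hnorm, MeasureTheory.integral_const, MeasureTheory.probReal_univ, one_smul]
      using hsum0)
  have hz : ∀ x, ∑' k, F k x = 0 := by
    intro x
    simp only [hFeq]
    rw [((h (w x) (hwD x)).mul_left _).tsum_eq, mul_zero]
  simp only [hz, MeasureTheory.integral_zero] at hs
  simp only [hF, MeasureTheory.integral_const_mul, integral_prod_fourier, mul_ite, mul_one,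
    mul_zero] at hs
  have h1 := hs.unique (hasSum_single l fun k hk => if_neg hk)
  rw [if_pos rfl] at h1
  exact (mul_eq_zero.mp h1.symm).resolve_left
    (Finset.prod_ne_zero_iff.mpr fun i _ => pow_ne_zero _ hr0)

variable (ι : Type*) [Fintype ι] (E : Type*) [NormedAddCommGroup E] [InnerProductSpace ℂ E]

/-- The `E`-valued functions on the polydisc of the form `f z = ∑ₖ zᵏ cₖ` with
`∑ₖ ‖cₖ‖² < ∞`, as a space of functions. -/
def hardySubmodule : Submodule ℂ (Polydisc ι → E) where
  carrier := {f | ∃ c : lp (fun _ : ι → ℕ => E) 2,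
    ∀ z : Polydisc ι, HasSum (fun k => multiPow k z.1 • c k) (f z)}
  add_mem' := by
    rintro f g ⟨c, hc⟩ ⟨d, hd⟩
    exact ⟨c + d, fun z => by simpa using (hc z).add (hd z)⟩
  zero_mem' := ⟨0, fun z => by simp⟩
  smul_mem' := by
    rintro a f ⟨c, hc⟩
    exact ⟨a • c, fun z => by
      have h := (hc z).const_smul a
      simp only [smul_comm a] at h
      exact h⟩

/-- The `E`-valued Hardy space `H²_E(𝔻^ι)`. -/
def HardySpace : Type _ := hardySubmodule ι E

namespace HardySpace

variable {ι E}

instance : AddCommGroup (HardySpace ι E) := inferInstanceAs (AddCommGroup (hardySubmodule ι E))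

instance : Module ℂ (HardySpace ι E) := inferInstanceAs (Module ℂ (hardySubmodule ι E))

instance : CoeFun (HardySpace ι E) fun _ => Polydisc ι → E := ⟨fun f => f.1⟩

theorem exists_coeff (f : HardySpace ι E) : ∃ c : lp (fun _ : ι → ℕ => E) 2,
    ∀ z : Polydisc ι, HasSum (fun k => multiPow k z.1 • c k) (f z) := f.2

theorem coeff_unique {g : Polydisc ι → E} {c d : (ι → ℕ) → E}
    (hc : ∀ z : Polydisc ι, HasSum (fun k => multiPow k z.1 • c k) (g z))
    (hd : ∀ z : Polydisc ι, HasSum (fun k => multiPow k z.1 • d k) (g z)) : c = d := by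
  funext l
  rw [← sub_eq_zero, ← inner_self_eq_zero (𝕜 := ℂ)]
  refine scalar_coeff_eq_zero (fun k => ⟪c l - d l, c k - d k⟫_ℂ) (fun z hz => ?_) l
  have := ((hc ⟨z, hz⟩).sub (hd ⟨z, hz⟩)).mapL (innerSL ℂ (c l - d l))
  simpa only [← smul_sub, innerSL_apply_apply, inner_smul_right, sub_self, inner_zero_right]
    using this

/-- The sequence of power series coefficients of a function in the Hardy space. -/
def coeff : HardySpace ι E →ₗ[ℂ] lp (fun _ : ι → ℕ => E) 2 where
  toFun f := f.exists_coeff.choose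
  map_add' f g := Subtype.ext <| coeff_unique (f + g).exists_coeff.choose_spec fun z => by
    have h := (f.exists_coeff.choose_spec z).add (g.exists_coeff.choose_spec z)
    simp only [← smul_add] at h
    exact h
  map_smul' a f := Subtype.ext <| coeff_unique (a • f).exists_coeff.choose_spec fun z => by
    have h := (f.exists_coeff.choose_spec z).const_smul a
    simp only [smul_comm a] at h
    exact h

theorem hasSum_coeff (f : HardySpace ι E) (z : Polydisc ι) :
    HasSum (fun k => multiPow k z.1 • coeff f k) (f z) := f.exists_coeff.choose_spec z

theorem coeff_injective : Function.Injective (coeff : HardySpace ι E →ₗ[ℂ] _) := by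
  intro f g h
  refine Subtype.ext (funext fun z => (f.hasSum_coeff z).unique ?_)
  rw [h]
  exact g.hasSum_coeff z

/-- The Hardy norm: `‖f‖² = ∑ₖ ‖cₖ‖²`. -/
instance : NormedAddCommGroup (HardySpace ι E) :=
  NormedAddCommGroup.induced _ _ (coeff : HardySpace ι E →ₗ[ℂ] _) coeff_injective

/-- The Hardy inner product: `⟪f, g⟫ = ∑ₖ ⟪cₖ(f), cₖ(g)⟫`. -/
instance : InnerProductSpace ℂ (HardySpace ι E) :=
  InnerProductSpace.induced (coeff : HardySpace ι E →ₗ[ℂ] _)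

/-- The elementary tensor `zᵏ ⊗ η`, i.e. the function `z ↦ zᵏ η`. -/
def monomial (k : ι → ℕ) (η : E) : HardySpace ι E :=
  ⟨fun z => multiPow k z.1 • η, by
    classical
    refine ⟨lp.single 2 k η, fun z => ?_⟩
    convert hasSum_ite_eq k (multiPow k z.1 • η) using 2 with j
    split_ifs with h
    · subst h; simp
    · simp [h]⟩

end HardySpace

/-! ### Doubly twisted near-isometries -/

section Operators

variable {H : Type*} [NormedAddCommGroup H] [InnerProductSpace ℂ H]

/-- A near-isometry: a bounded below contraction with `T*ᵐ Tᵐ⁺¹ H ⊆ T H` for all `m ≥ 0`. -/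
structure IsNearIsometry [CompleteSpace H] (T : H →L[ℂ] H) : Prop where
  bounds : ∃ δ : ℝ, 0 < δ ∧ ∀ x, δ * ‖x‖ ≤ ‖T x‖ ∧ ‖T x‖ ≤ ‖x‖
  range_le : ∀ (m : ℕ) (x : H),
    ((ContinuousLinearMap.adjoint T) ^ m) ((T ^ (m + 1)) x) ∈ Set.range T

/-- `T = (T₁, …, Tₙ)` is a doubly twisted near-isometry with respect to the commuting unitaries
`U i j`, `i < j` (the values `U i j` with `i ≥ j` play no role). -/
structure IsDoublyTwistedNearIsometry [CompleteSpace H] {n : ℕ} (T : Fin n → H →L[ℂ] H)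
    (U : Fin n → Fin n → H →L[ℂ] H) : Prop where
  two_le : 2 ≤ n
  unitary : ∀ i j, i < j → U i j ∈ unitary (H →L[ℂ] H)
  commute : ∀ i j p q, i < j → p < q → U i j * U p q = U p q * U i j
  nearIsometry : ∀ i, IsNearIsometry (T i)
  adjoint_mul : ∀ i j, i < j → ContinuousLinearMap.adjoint (T i) * T j =
    ContinuousLinearMap.adjoint (U i j) * T j * ContinuousLinearMap.adjoint (T i)
  mul_unitary : ∀ i j k, i < j → T k * U i j = U i j * T k
  mul_mul : ∀ i j, i < j → T i * T j = U i j * T j * T i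

variable {n : ℕ}

/-- `T_A ^ k = T_{a₁} ^ k₁ ⋯ T_{aₘ} ^ kₘ` for `A = {a₁ < ⋯ < aₘ}`, the factors being taken in
increasing order of the index; the multi-index `k` is indexed by the elements of `A`. -/
def tuplePow (T : Fin n → H →L[ℂ] H) (A : Finset (Fin n)) (k : A → ℕ) : H →L[ℂ] H :=
  ((List.finRange n).map fun i => if h : i ∈ A then T i ^ k ⟨i, h⟩ else 1).prod

/-- `W_A = ⋂_{i ∈ A} ker T_i*`. -/
def kernelSubspace [CompleteSpace H] (T : Fin n → H →L[ℂ] H) (A : Finset (Fin n)) :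
    Submodule ℂ H :=
  ⨅ i ∈ A, (ContinuousLinearMap.adjoint (T i)).ker

/-- The image `L D` of a subspace `D` under an operator `L`. -/
abbrev imageSubspace (L : H →L[ℂ] H) (D : Submodule ℂ H) : Submodule ℂ H :=
  D.map (L : H →ₗ[ℂ] H)

/-- The `A`-wandering subspace `D_A = ⋂_ℓ T_{Aᶜ} ^ ℓ W_A`. -/
def wanderingSubspace [CompleteSpace H] (T : Fin n → H →L[ℂ] H) (A : Finset (Fin n)) :
    Submodule ℂ H :=
  ⨅ l : (Aᶜ : Finset (Fin n)) → ℕ, imageSubspace (tuplePow T Aᶜ l) (kernelSubspace T A)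

/-- `Λ : D → L D` is the unitary factor of the polar decomposition `L|_D = Λ |L|_D|` of the
restriction `L|_D : D → L D`: one has `L|_D = Λ P` with `P` a positive operator on `D`. -/
def IsPolarUnitary (L : H →L[ℂ] H) (D : Submodule ℂ H) (Λ : D ≃ₗᵢ[ℂ] imageSubspace L D) : Prop :=
  ∃ P : D →L[ℂ] D, P.IsPositive ∧ ∀ x : D, L x = Λ (P x)

/-- The Hilbert space direct sum of operators `M a` on `E a`, over a finite index set. -/
def directSumOperator {α : Type*} [Fintype α] {E : α → Type*} [∀ a, NormedAddCommGroup (E a)]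
    [∀ a, InnerProductSpace ℂ (E a)] (M : ∀ a, E a →L[ℂ] E a) : PiLp 2 E →L[ℂ] PiLp 2 E :=
  (PiLp.continuousLinearEquiv 2 ℂ E).symm.toContinuousLinearMap ∘L
    ContinuousLinearMap.piMap M ∘L (PiLp.continuousLinearEquiv 2 ℂ E).toContinuousLinearMap

/-- Unitary equivalence of tuples: `U T_i U* = S_i` for all `i`, for one unitary `U`. -/
def TupleUnitarilyEquivalent {α K : Type*} [NormedAddCommGroup K] [InnerProductSpace ℂ K]
    (T : α → H →L[ℂ] H) (S : α → K →L[ℂ] K) : Prop :=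
  ∃ U : H ≃ₗᵢ[ℂ] K, ∀ i y, U (T i (U.symm y)) = S i y

end Operators

end

/-!
Each `T i` has a Wold decomposition `H = ⋂ₘ Tᵢᵐ H ⊕ ⨁ₘ Tᵢᵐ (ker Tᵢ*)`. The twisted commutation
relations make each of its components reducing for every other `T j`, so the projections onto the
components of `T i` preserve the components of `T j`, and intersecting the `n` decompositions yields
an orthogonal decomposition of `H` indexed by `α ∈ (ℕ ∪ {∞})ⁿ`. The operator `T i` maps the
component of index `α` onto the one of index `α + eᵢ`, where `∞ + 1 = ∞`; hence the component of
index `α` is `T_A ^ k D_A`, where `A` is the set of indices `i` with `αᵢ` finite and `k` is the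
restriction of `α` to `A`. The unitary `V` sends `Λ_{A,k} η` to `zᵏ ⊗ η`.
-/

section BoundedBelow

variable {𝕜 E : Type*} [NontriviallyNormedField 𝕜] [NormedAddCommGroup E] [NormedSpace 𝕜 E]

variable (𝕜 E) in
/-- The monoid of operators that are bounded below, `δ‖x‖ ≤ ‖T x‖` for some `δ > 0`, encoded by
`AntilipschitzWith` with constant `δ⁻¹`. -/
def boundedBelow : Submonoid (E →L[𝕜] E) where
  carrier := {T | ∃ K, AntilipschitzWith K T}
  one_mem' := ⟨1, .id⟩
  mul_mem' := fun ⟨_, hS⟩ ⟨_, hT⟩ => ⟨_, hS.comp hT⟩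

theorem mem_boundedBelow_of_bound {T : E →L[𝕜] E} {δ : ℝ} (hδ : 0 < δ)
    (h : ∀ x, δ * ‖x‖ ≤ ‖T x‖) : T ∈ boundedBelow 𝕜 E := by
  refine ⟨⟨δ⁻¹, by positivity⟩, T.antilipschitz_of_bound fun x => ?_⟩
  change ‖x‖ ≤ δ⁻¹ * ‖T x‖
  rw [← div_eq_inv_mul, le_div_iff₀' hδ]
  exact h x

theorem injective_of_mem_boundedBelow {T : E →L[𝕜] E} (hT : T ∈ boundedBelow 𝕜 E) :
    Function.Injective T :=
  let ⟨_, hK⟩ := hT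
  hK.injective

theorem isClosed_map_of_mem_boundedBelow [CompleteSpace E] {T : E →L[𝕜] E}
    (hT : T ∈ boundedBelow 𝕜 E) {D : Submodule 𝕜 E} (hD : IsClosed (D : Set E)) :
    IsClosed (D.map (T : E →ₗ[𝕜] E) : Set E) := by
  obtain ⟨K, hK⟩ := hT
  rw [Submodule.map_coe]
  exact (hK.isClosedEmbedding T.uniformContinuous).isClosedMap _ hD

theorem antitone_range_pow (T : E →L[𝕜] E) : Antitone fun m : ℕ => (T ^ m).range :=
  antitone_nat_of_succ_le fun m => by
    rintro _ ⟨y, rfl⟩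
    exact ⟨T y, rfl⟩

end BoundedBelow

section DoublyTwisted

variable {R : Type*} [Monoid R] [StarMul R] {S T : R}

/-- `S` and `T` doubly commute up to a unitary twist `V` that commutes with both of them. -/
def DoublyTwisted (S T : R) : Prop :=
  ∃ V ∈ unitary R, Commute V S ∧ Commute V T ∧ S * T = V * T * S ∧ star S * T = star V * T * star S

theorem commute_star_left_of_mem_unitary {V : R} (hV : V ∈ unitary R) (h : Commute V T) :
    Commute (star V) T :=
  Commute.units_inv_left (u := Unitary.toUnits ⟨V, hV⟩) h

theorem commute_star_right_of_mem_unitary {V : R} (hV : V ∈ unitary R) (h : Commute V T) :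
    Commute V (star T) := by
  simpa only [star_star] using (commute_star_left_of_mem_unitary hV h).star_star

theorem DoublyTwisted.symm (h : DoublyTwisted S T) : DoublyTwisted T S := by
  obtain ⟨V, hV, hVS, hVT, hmul, hstar⟩ := h
  refine ⟨star V, Unitary.star_mem hV, commute_star_left_of_mem_unitary hV hVT,
    commute_star_left_of_mem_unitary hV hVS, ?_, ?_⟩
  · rw [mul_assoc, hmul, ← mul_assoc, ← mul_assoc, Unitary.star_mul_self_of_mem hV, one_mul]
  · have h := congrArg star hstar
    simp only [star_mul, star_star] at h
    rw [h, star_star, ← (commute_star_right_of_mem_unitary hV hVT).eq, ← mul_assoc, hVS.eq]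

theorem DoublyTwisted.star_left (h : DoublyTwisted S T) : DoublyTwisted (star S) T := by
  obtain ⟨V, hV, hVS, hVT, hmul, hstar⟩ := h
  exact ⟨star V, Unitary.star_mem hV, hVS.star_star, commute_star_left_of_mem_unitary hV hVT,
    hstar, by simpa only [star_star] using hmul⟩

theorem doublyTwisted_of_isSelfAdjoint (hS : IsSelfAdjoint S) (h : Commute S T) :
    DoublyTwisted S T :=
  ⟨1, one_mem _, .one_left S, .one_left T, by rw [one_mul, h.eq],
    by rw [star_one, one_mul, hS.star_eq, h.eq]⟩

end DoublyTwisted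

section HilbertSpace

variable {𝕜 E : Type*} [RCLike 𝕜] [NormedAddCommGroup E] [InnerProductSpace 𝕜 E]

theorem commute_starProjection [CompleteSpace E] {K : Submodule 𝕜 E} [K.HasOrthogonalProjection]
    {S : E →L[𝕜] E} (hS : ∀ x ∈ K, S x ∈ K) (hS' : ∀ x ∈ K, star S x ∈ K) :
    Commute K.starProjection S := by
  rw [ContinuousLinearMap.IsIdempotentElem.commute_iff K.isIdempotentElem_starProjection,
    K.range_starProjection, K.ker_starProjection]
  exact ⟨hS, ContinuousLinearMap.orthogonal_mem_invtSubmodule hS'⟩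

theorem iInf_orthogonal_inf_eq_bot {ι κ : Type*} {K : ι → Submodule 𝕜 E} {L : κ → Submodule 𝕜 E}
    [∀ a, (K a).HasOrthogonalProjection] (hK : ⨅ a, (K a)ᗮ = ⊥) (hL : ⨅ b, (L b)ᗮ = ⊥)
    (hKL : ∀ a b, ∀ x ∈ L b, (K a).starProjection x ∈ L b) :
    ⨅ a, ⨅ b, (K a ⊓ L b)ᗮ = ⊥ := by
  refine eq_bot_iff.2 fun x hx => hK.le ?_
  simp only [Submodule.mem_iInf] at hx ⊢
  intro a
  rw [← Submodule.starProjection_apply_eq_zero_iff, ← Submodule.mem_bot 𝕜, ← hL, Submodule.mem_iInf]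
  intro b z hz
  rw [← Submodule.inner_starProjection_left_eq_right]
  exact hx a b _ ⟨Submodule.starProjection_apply_mem _ _, hKL a b z hz⟩

end HilbertSpace

section Wold

open ContinuousLinearMap (adjoint)

variable {𝕜 E : Type*} [RCLike 𝕜] [NormedAddCommGroup E] [InnerProductSpace 𝕜 E] [CompleteSpace E]
  {T : E →L[𝕜] E}

/-- The operators for which the Wold decomposition `E = ⋂ₘ Tᵐ E ⊕ ⨁ₘ Tᵐ (ker T*)` is established.
Since the range of `T` is closed, the second condition says that `Tᵐ (ker T*) ⟂ Tᵐ⁺¹ E` for all `m`.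
Near-isometries are the contractive ones among these. -/
structure IsWoldOperator (T : E →L[𝕜] E) : Prop where
  mem_boundedBelow : T ∈ boundedBelow 𝕜 E
  adjoint_pow_pow_succ_mem_range (m : ℕ) (x : E) :
    (adjoint T ^ m) ((T ^ (m + 1)) x) ∈ Set.range T

/-- The components of the Wold decomposition of `T`: the subspaces `Tᵐ (ker T*)` for finite `m`,
and `⋂ₘ Tᵐ E` for `m = ∞`. -/
noncomputable def woldComponent (T : E →L[𝕜] E) (α : ℕ∞) : Submodule 𝕜 E :=
  α.recTopCoe (⨅ m : ℕ, (T ^ m).range) fun m =>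
    (adjoint T).ker.map ((T ^ m : E →L[𝕜] E) : E →ₗ[𝕜] E)

theorem woldComponent_top : woldComponent T ⊤ = ⨅ m : ℕ, (T ^ m).range := by
  rw [woldComponent, ENat.recTopCoe_top]

theorem woldComponent_coe (m : ℕ) :
    woldComponent T m = (adjoint T).ker.map ((T ^ m : E →L[𝕜] E) : E →ₗ[𝕜] E) := by
  rw [woldComponent, ENat.recTopCoe_natCast]

theorem mem_woldComponent_top {x : E} : x ∈ woldComponent T ⊤ ↔ ∀ m : ℕ, ∃ y, (T ^ m) y = x := by
  simp only [woldComponent_top, Submodule.mem_iInf, LinearMap.mem_range,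
    ContinuousLinearMap.coe_coe]

theorem mem_woldComponent_coe {m : ℕ} {x : E} :
    x ∈ woldComponent T m ↔ ∃ y, adjoint T y = 0 ∧ (T ^ m) y = x := by
  simp only [woldComponent_coe, Submodule.mem_map, LinearMap.mem_ker, ContinuousLinearMap.coe_coe]

theorem isClosed_woldComponent (hT : T ∈ boundedBelow 𝕜 E) (α : ℕ∞) :
    IsClosed (woldComponent T α : Set E) := by
  induction α with
  | top =>
    rw [woldComponent_top, Submodule.coe_iInf]
    refine isClosed_iInter fun m => ?_
    rw [LinearMap.range_eq_map]
    exact isClosed_map_of_mem_boundedBelow (pow_mem hT m) isClosed_univ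
  | coe m =>
    rw [woldComponent_coe]
    exact isClosed_map_of_mem_boundedBelow (pow_mem hT m) (ContinuousLinearMap.isClosed_ker _)

theorem hasOrthogonalProjection_woldComponent (hT : T ∈ boundedBelow 𝕜 E) (α : ℕ∞) :
    (woldComponent T α).HasOrthogonalProjection :=
  have := (isClosed_woldComponent hT α).completeSpace_coe
  inferInstance

theorem map_woldComponent (hT : Function.Injective T) (α : ℕ∞) :
    (woldComponent T α).map (T : E →ₗ[𝕜] E) = woldComponent T (α + 1) := by
  induction α with
  | top =>
    rw [top_add, woldComponent_top, Submodule.map_iInf _ hT,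
      ← (antitone_range_pow T).iInf_nat_add 1]
    refine iInf_congr fun m => ?_
    rw [pow_succ']
    exact (LinearMap.range_comp _ _).symm
  | coe m =>
    rw [← Nat.cast_succ, woldComponent_coe, woldComponent_coe, ← Submodule.map_comp, pow_succ']
    rfl

theorem woldComponent_le_range_pow {α : ℕ∞} {m : ℕ} (h : m ≤ α) :
    woldComponent T α ≤ (T ^ m).range := by
  induction α with
  | top => exact woldComponent_top.trans_le (iInf_le _ m)
  | coe l =>
    rw [woldComponent_coe]
    exact LinearMap.map_le_range.trans (antitone_range_pow T (Nat.cast_le.1 h))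

theorem inner_pow_left (T : E →L[𝕜] E) (m : ℕ) (x y : E) :
    ⟪(T ^ m) x, y⟫_𝕜 = ⟪x, (adjoint T ^ m) y⟫_𝕜 := by
  rw [← ContinuousLinearMap.adjoint_inner_right, ← ContinuousLinearMap.star_eq_adjoint, star_pow,
    ContinuousLinearMap.star_eq_adjoint]

theorem IsWoldOperator.isOrtho_woldComponent_range_pow_succ (hT : IsWoldOperator T) (m : ℕ) :
    woldComponent T m ⟂ (T ^ (m + 1)).range := by
  rw [Submodule.isOrtho_iff_inner_eq]
  intro x hx _ hy
  obtain ⟨w, hw, rfl⟩ := mem_woldComponent_coe.1 hx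
  obtain ⟨y, rfl⟩ := hy
  obtain ⟨z, hz⟩ := hT.adjoint_pow_pow_succ_mem_range m y
  calc ⟪(T ^ m) w, (T ^ (m + 1)) y⟫_𝕜 = ⟪w, T z⟫_𝕜 := by rw [inner_pow_left, hz]
    _ = 0 := by rw [← ContinuousLinearMap.adjoint_inner_left, hw, inner_zero_left]

theorem IsWoldOperator.isOrtho_woldComponent (hT : IsWoldOperator T) :
    Pairwise fun α β : ℕ∞ => woldComponent T α ⟂ woldComponent T β := by
  intro α β h
  wlog hlt : α < β generalizing α β
  · exact (this h.symm (h.lt_or_gt.resolve_left hlt)).symm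
  obtain ⟨m, rfl⟩ := ENat.ne_top_iff_exists.1 hlt.ne_top
  refine (hT.isOrtho_woldComponent_range_pow_succ m).mono_right (woldComponent_le_range_pow ?_)
  exact_mod_cast Order.add_one_le_of_lt hlt

theorem IsWoldOperator.iInf_orthogonal_woldComponent (hT : IsWoldOperator T) :
    ⨅ α, (woldComponent T α)ᗮ = ⊥ := by
  refine eq_bot_iff.2 fun x hx => ?_
  rw [Submodule.mem_iInf] at hx
  suffices hmem : ∀ m : ℕ, ∃ y, (T ^ m) y = x from
    inner_self_eq_zero.1 (hx ⊤ x (mem_woldComponent_top.2 hmem))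
  intro m
  induction m with
  | zero => exact ⟨x, rfl⟩
  | succ m ih =>
    obtain ⟨y, rfl⟩ := ih
    obtain ⟨_, hK⟩ := hT.mem_boundedBelow
    have := hK.completeSpace_range_clm
    obtain ⟨-, ⟨z, rfl⟩, w, hw, rfl⟩ := T.range.exists_add_mem_mem_orthogonal y
    rw [ContinuousLinearMap.orthogonal_range] at hw
    have hwm : (T ^ m) w ∈ woldComponent T m := mem_woldComponent_coe.2 ⟨w, hw, rfl⟩
    have hzw : ⟪(T ^ m) w, (T ^ (m + 1)) z⟫_𝕜 = 0 :=
      (hT.isOrtho_woldComponent_range_pow_succ m).inner_eq hwm ⟨z, rfl⟩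
    have hsplit : (T ^ m) (T z + w) = (T ^ (m + 1)) z + (T ^ m) w := by
      rw [map_add, pow_succ]
      rfl
    have hw0 : (T ^ m) w = 0 := by
      have h := hx m _ hwm
      rwa [ContinuousLinearMap.coe_coe, hsplit, inner_add_right, hzw, zero_add,
        inner_self_eq_zero] at h
    exact ⟨z, by rw [ContinuousLinearMap.coe_coe, hsplit, hw0, add_zero]⟩

theorem DoublyTwisted.adjoint_apply_eq_zero {S : E →L[𝕜] E} (h : DoublyTwisted S T) {y : E}
    (hy : adjoint T y = 0) : adjoint T (S y) = 0 := by
  obtain ⟨V, -, -, -, -, hstar⟩ := h.symm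
  calc adjoint T (S y) = star V (S (adjoint T y)) := DFunLike.congr_fun hstar y
    _ = 0 := by rw [hy, map_zero, map_zero]

theorem DoublyTwisted.apply_mem_woldComponent {S : E →L[𝕜] E} (h : DoublyTwisted S T) {α : ℕ∞}
    {x : E} (hx : x ∈ woldComponent T α) : S x ∈ woldComponent T α := by
  obtain ⟨V, hV, -, hVT, hmul, -⟩ := id h
  have hpow (m : ℕ) (y : E) : S ((T ^ m) y) = (T ^ m) ((V ^ m) (S y)) := by
    have hsemi : S * T ^ m = T ^ m * V ^ m * S := by
      rw [← (hVT.pow_pow m m).eq, ← hVT.mul_pow]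
      exact SemiconjBy.pow_right hmul m
    exact DFunLike.congr_fun hsemi y
  induction α with
  | top =>
    rw [mem_woldComponent_top] at hx ⊢
    intro m
    obtain ⟨y, rfl⟩ := hx m
    exact ⟨_, (hpow m y).symm⟩
  | coe m =>
    rw [mem_woldComponent_coe] at hx ⊢
    obtain ⟨y, hy, rfl⟩ := hx
    refine ⟨_, ?_, (hpow m y).symm⟩
    calc adjoint T ((V ^ m) (S y)) = (V ^ m) (adjoint T (S y)) :=
          (DFunLike.congr_fun ((commute_star_right_of_mem_unitary hV hVT).pow_left m).eq _).symm
      _ = 0 := by rw [h.adjoint_apply_eq_zero hy, map_zero]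

theorem DoublyTwisted.commute_starProjection_woldComponent {S : E →L[𝕜] E}
    (h : DoublyTwisted S T) (α : ℕ∞) [(woldComponent T α).HasOrthogonalProjection] :
    Commute (woldComponent T α).starProjection S :=
  commute_starProjection (fun _ hx => h.apply_mem_woldComponent hx)
    fun _ hx => h.star_left.apply_mem_woldComponent hx

theorem DoublyTwisted.apply_mem_woldComponent_iff {S : E →L[𝕜] E} (h : DoublyTwisted S T)
    (hS : Function.Injective S) {α : ℕ∞} [(woldComponent T α).HasOrthogonalProjection] {x : E} :
    S x ∈ woldComponent T α ↔ x ∈ woldComponent T α := by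
  have hcomm : (woldComponent T α).starProjection (S x) =
      S ((woldComponent T α).starProjection x) :=
    DFunLike.congr_fun (h.commute_starProjection_woldComponent α).eq x
  rw [← Submodule.starProjection_eq_self_iff, hcomm, hS.eq_iff,
    Submodule.starProjection_eq_self_iff]

theorem DoublyTwisted.starProjection_apply_mem_woldComponent {S : E →L[𝕜] E}
    (h : DoublyTwisted S T) {α β : ℕ∞} [(woldComponent T α).HasOrthogonalProjection] {x : E}
    (hx : x ∈ woldComponent S β) : (woldComponent T α).starProjection x ∈ woldComponent S β :=
  (doublyTwisted_of_isSelfAdjoint (isSelfAdjoint_starProjection _)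
    (h.commute_starProjection_woldComponent α)).apply_mem_woldComponent hx

end Wold

section JointWold

variable {𝕜 E ι : Type*} [RCLike 𝕜] [NormedAddCommGroup E] [InnerProductSpace 𝕜 E]
  [CompleteSpace E] {T : ι → E →L[𝕜] E}

/-- The intersection `⋂ᵢ E_{i, αᵢ}` of the Wold components `E_{i, αᵢ}` of the members `T i` of a
tuple. -/
noncomputable def jointWoldComponent (T : ι → E →L[𝕜] E) (α : ι → ℕ∞) : Submodule 𝕜 E :=
  ⨅ i, woldComponent (T i) (α i)

theorem mem_jointWoldComponent {α : ι → ℕ∞} {x : E} :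
    x ∈ jointWoldComponent T α ↔ ∀ i, x ∈ woldComponent (T i) (α i) :=
  Submodule.mem_iInf _

theorem isClosed_jointWoldComponent (hT : ∀ i, T i ∈ boundedBelow 𝕜 E) (α : ι → ℕ∞) :
    IsClosed (jointWoldComponent T α : Set E) := by
  rw [jointWoldComponent, Submodule.coe_iInf]
  exact isClosed_iInter fun i => isClosed_woldComponent (hT i) (α i)

theorem isOrtho_jointWoldComponent (hT : ∀ i, IsWoldOperator (T i)) :
    Pairwise fun α β : ι → ℕ∞ => jointWoldComponent T α ⟂ jointWoldComponent T β := by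
  intro α β h
  obtain ⟨i, hi⟩ := Function.ne_iff.1 h
  exact ((hT i).isOrtho_woldComponent hi).mono (iInf_le _ i) (iInf_le _ i)

theorem iInf_orthogonal_biInf_woldComponent (hT : ∀ i, IsWoldOperator (T i))
    (hTT : Pairwise fun i j => DoublyTwisted (T i) (T j)) (s : Finset ι) :
    ⨅ α : ι → ℕ∞, (⨅ i ∈ s, woldComponent (T i) (α i))ᗮ = ⊥ := by
  classical
  induction s using Finset.induction_on with
  | empty => simp
  | insert j s hj ih =>
    have (a : ℕ∞) := hasOrthogonalProjection_woldComponent (hT j).mem_boundedBelow a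
    rw [eq_bot_iff, ← iInf_orthogonal_inf_eq_bot (hT j).iInf_orthogonal_woldComponent ih]
    · refine le_iInf₂ fun a α => iInf_le_of_le (Function.update α j a) (Submodule.orthogonal_le ?_)
      rw [Finset.iInf_insert, Function.update_self]
      refine inf_le_inf_left _ (le_iInf₂ fun i hi => (iInf₂_le i hi).trans_eq ?_)
      rw [Function.update_of_ne (ne_of_mem_of_not_mem hi hj)]
    · intro a α x hx
      simp only [Submodule.mem_iInf] at hx ⊢
      exact fun i hi => (hTT (ne_of_mem_of_not_mem hi hj)).starProjection_apply_mem_woldComponent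
        (hx i hi)

theorem iInf_orthogonal_jointWoldComponent [Finite ι] (hT : ∀ i, IsWoldOperator (T i))
    (hTT : Pairwise fun i j => DoublyTwisted (T i) (T j)) :
    ⨅ α : ι → ℕ∞, (jointWoldComponent T α)ᗮ = ⊥ := by
  have := Fintype.ofFinite ι
  simpa only [jointWoldComponent, Finset.mem_univ, iInf_pos] using
    iInf_orthogonal_biInf_woldComponent hT hTT Finset.univ

variable [DecidableEq ι]

theorem map_jointWoldComponent (hT : ∀ i, T i ∈ boundedBelow 𝕜 E)
    (hTT : Pairwise fun i j => DoublyTwisted (T i) (T j)) (i : ι) (α : ι → ℕ∞) :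
    (jointWoldComponent T α).map (T i : E →ₗ[𝕜] E) = jointWoldComponent T (α + Pi.single i 1) := by
  have hinj : Function.Injective (T i) := injective_of_mem_boundedBelow (hT i)
  have hiff (y : E) : T i y ∈ jointWoldComponent T (α + Pi.single i 1) ↔
      y ∈ jointWoldComponent T α := by
    simp only [mem_jointWoldComponent, Pi.add_apply]
    refine forall_congr' fun j => ?_
    have := hasOrthogonalProjection_woldComponent (hT j) (α j)
    rcases eq_or_ne i j with rfl | hij
    · rw [Pi.single_eq_same, ← map_woldComponent hinj]
      exact hinj.mem_set_image
    · rw [Pi.single_eq_of_ne' hij, add_zero, (hTT hij).apply_mem_woldComponent_iff hinj]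
  ext x
  refine ⟨fun ⟨y, hy, hyx⟩ => hyx ▸ (hiff y).2 hy, fun hx => ?_⟩
  have hxi := mem_jointWoldComponent.1 hx i
  rw [Pi.add_apply, Pi.single_eq_same, ← map_woldComponent hinj] at hxi
  obtain ⟨y, -, rfl⟩ := hxi
  exact ⟨y, (hiff y).1 hx, rfl⟩

theorem map_pow_jointWoldComponent (hT : ∀ i, T i ∈ boundedBelow 𝕜 E)
    (hTT : Pairwise fun i j => DoublyTwisted (T i) (T j)) (i : ι) (m : ℕ) (α : ι → ℕ∞) :
    (jointWoldComponent T α).map ((T i ^ m : E →L[𝕜] E) : E →ₗ[𝕜] E) =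
      jointWoldComponent T (α + Pi.single i (m : ℕ∞)) := by
  induction m generalizing α with
  | zero =>
    rw [Nat.cast_zero, Pi.single_zero, add_zero]
    exact Submodule.map_id _
  | succ m ih =>
    rw [pow_succ, ContinuousLinearMap.toLinearMap_mul, Module.End.mul_eq_comp, Submodule.map_comp,
      map_jointWoldComponent hT hTT, ih, add_assoc, ← Pi.single_add, Nat.cast_succ, add_comm 1]

theorem map_list_prod_pow_jointWoldComponent (hT : ∀ i, T i ∈ boundedBelow 𝕜 E)
    (hTT : Pairwise fun i j => DoublyTwisted (T i) (T j)) (k : ι → ℕ) (l : List ι) (α : ι → ℕ∞) :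
    (jointWoldComponent T α).map ((l.map fun i => T i ^ k i).prod : E →ₗ[𝕜] E) =
      jointWoldComponent T (α + (l.map fun i => Pi.single i (k i : ℕ∞)).sum) := by
  induction l with
  | nil =>
    rw [List.map_nil, List.map_nil, List.sum_nil, add_zero]
    exact Submodule.map_id _
  | cons i l ih =>
    simp only [List.map_cons, List.prod_cons, List.sum_cons]
    rw [ContinuousLinearMap.toLinearMap_mul, Module.End.mul_eq_comp, Submodule.map_comp, ih,
      map_pow_jointWoldComponent hT hTT, add_assoc, add_comm (List.sum _)]

end JointWold

section MultiIndex

variable {ι : Type*} {A : Finset ι}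

/-- The index of a joint Wold component attached to a multi-index `k` on `A`: the value is `k` on
`A` and `∞` off `A`. -/
noncomputable def woldIndex (A : Finset ι) (k : A → ℕ) : ι → ℕ∞ :=
  Function.extend Subtype.val (fun i => (k i : ℕ∞)) ⊤

theorem woldIndex_apply_of_mem (k : A → ℕ) {i : ι} (hi : i ∈ A) :
    woldIndex A k i = k ⟨i, hi⟩ :=
  Function.extend_val_apply hi

theorem woldIndex_apply_of_notMem (k : A → ℕ) {i : ι} (hi : i ∉ A) : woldIndex A k i = ⊤ :=
  Function.extend_val_apply' hi

theorem woldIndex_apply_ne_top_iff (k : A → ℕ) {i : ι} : woldIndex A k i ≠ ⊤ ↔ i ∈ A := by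
  by_cases hi : i ∈ A
  · simp [woldIndex_apply_of_mem k hi, hi]
  · simp [woldIndex_apply_of_notMem k hi, hi]

theorem woldIndex_bijective [Finite ι] :
    Function.Bijective fun p : Σ A : Finset ι, A → ℕ => woldIndex p.1 p.2 := by
  classical
  have := Fintype.ofFinite ι
  refine ⟨fun ⟨A, k⟩ ⟨B, l⟩ h => ?_, fun α => ?_⟩
  · obtain rfl : A = B := Finset.ext fun i => by
      rw [← woldIndex_apply_ne_top_iff k, ← woldIndex_apply_ne_top_iff l]
      exact not_congr (Eq.congr_left (congrFun h i))
    congr 1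
    funext i
    have hi := congrFun h i
    simp only [woldIndex_apply_of_mem _ i.2] at hi
    exact_mod_cast hi
  · refine ⟨⟨Finset.univ.filter fun i => α i ≠ ⊤, fun i => (α i).toNat⟩, funext fun i => ?_⟩
    change woldIndex _ _ i = α i
    by_cases h : α i = ⊤
    · rw [woldIndex_apply_of_notMem _ (by simp [h]), h]
    · rw [woldIndex_apply_of_mem _ (by simp [h]), ENat.natCast_toNat h]

theorem woldIndex_add_extend (k l : A → ℕ) :
    (woldIndex A k + fun i => ((Function.extend Subtype.val l 0 i : ℕ) : ℕ∞)) =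
      woldIndex A (k + l) := by
  funext i
  rw [Pi.add_apply]
  by_cases hi : i ∈ A
  · rw [woldIndex_apply_of_mem _ hi, woldIndex_apply_of_mem _ hi, Function.extend_val_apply hi,
      Pi.add_apply, Nat.cast_add]
  · rw [woldIndex_apply_of_notMem _ hi, woldIndex_apply_of_notMem _ hi, top_add]

theorem woldIndex_add_extend_compl [Fintype ι] [DecidableEq ι] (k : A → ℕ)
    (l : (Aᶜ : Finset ι) → ℕ) :
    (woldIndex A k + fun i => ((Function.extend Subtype.val l 0 i : ℕ) : ℕ∞)) = woldIndex A k := by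
  funext i
  rw [Pi.add_apply]
  by_cases hi : i ∈ A
  · rw [Function.extend_val_apply' (by simpa using hi), Pi.zero_apply, Nat.cast_zero, add_zero]
  · rw [woldIndex_apply_of_notMem _ hi, top_add]

end MultiIndex

section TuplePow

variable {n : ℕ} {H : Type*} [NormedAddCommGroup H] [InnerProductSpace ℂ H]
  {T : Fin n → H →L[ℂ] H} {A : Finset (Fin n)}

theorem tuplePow_eq_prod_pow_extend (T : Fin n → H →L[ℂ] H) (A : Finset (Fin n)) (k : A → ℕ) :
    tuplePow T A k =
      ((List.finRange n).map fun i => T i ^ (Function.extend Subtype.val k 0 i : ℕ)).prod := by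
  rw [tuplePow]
  congr 2
  funext i
  split_ifs with hi
  · rw [Function.extend_val_apply hi]
  · rw [Function.extend_val_apply' hi, Pi.zero_apply, pow_zero]

theorem tuplePow_zero (T : Fin n → H →L[ℂ] H) (A : Finset (Fin n)) : tuplePow T A 0 = 1 := by
  refine List.prod_eq_one fun S hS => ?_
  obtain ⟨i, -, rfl⟩ := List.mem_map.1 hS
  split_ifs <;> simp

theorem tuplePow_single (T : Fin n → H →L[ℂ] H) (i : A) (m : ℕ) :
    tuplePow T A (Pi.single i m) = T i ^ m := by
  rw [tuplePow, List.prod_map_eq_pow_single (i : Fin n),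
    List.count_eq_one_of_mem (List.nodup_finRange n) (List.mem_finRange _), pow_one,
    dif_pos i.2, Pi.single_eq_same]
  intro j hj _
  split_ifs with h
  · rw [Pi.single_eq_of_ne fun h => hj (congrArg Subtype.val h), pow_zero]
  · rfl

theorem tuplePow_mem_boundedBelow (hT : ∀ i, T i ∈ boundedBelow ℂ H) (k : A → ℕ) :
    tuplePow T A k ∈ boundedBelow ℂ H := by
  rw [tuplePow_eq_prod_pow_extend]
  refine list_prod_mem fun S hS => ?_
  obtain ⟨i, -, rfl⟩ := List.mem_map.1 hS
  exact pow_mem (hT i) _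

variable [CompleteSpace H]

theorem map_tuplePow_jointWoldComponent (hT : ∀ i, T i ∈ boundedBelow ℂ H)
    (hTT : Pairwise fun i j => DoublyTwisted (T i) (T j)) (k : A → ℕ) (α : Fin n → ℕ∞) :
    imageSubspace (tuplePow T A k) (jointWoldComponent T α) =
      jointWoldComponent T
        (α + fun i => ((Function.extend Subtype.val k 0 i : ℕ) : ℕ∞)) := by
  rw [tuplePow_eq_prod_pow_extend, imageSubspace, map_list_prod_pow_jointWoldComponent hT hTT,
    ← Fin.sum_univ_def, Finset.univ_sum_single]

theorem wanderingSubspace_le_jointWoldComponent (T : Fin n → H →L[ℂ] H) (A : Finset (Fin n)) :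
    wanderingSubspace T A ≤ jointWoldComponent T (woldIndex A 0) := by
  intro x hx
  rw [wanderingSubspace, Submodule.mem_iInf] at hx
  refine mem_jointWoldComponent.2 fun i => ?_
  by_cases hi : i ∈ A
  · obtain ⟨y, hy, rfl⟩ := hx 0
    simp only [kernelSubspace, SetLike.mem_coe, Submodule.mem_iInf] at hy
    rw [woldIndex_apply_of_mem _ hi, tuplePow_zero]
    exact mem_woldComponent_coe.2 ⟨y, hy i hi, rfl⟩
  · rw [woldIndex_apply_of_notMem _ hi, mem_woldComponent_top]
    intro m
    obtain ⟨y, -, rfl⟩ := hx (Pi.single ⟨i, Finset.mem_compl.2 hi⟩ m)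
    exact ⟨y, by rw [tuplePow_single]; rfl⟩

theorem jointWoldComponent_le_kernelSubspace (T : Fin n → H →L[ℂ] H) (A : Finset (Fin n)) :
    jointWoldComponent T (woldIndex A 0) ≤ kernelSubspace T A := by
  refine le_iInf₂ fun i hi x hx => ?_
  have hxi := mem_jointWoldComponent.1 hx i
  rw [woldIndex_apply_of_mem _ hi, Pi.zero_apply, mem_woldComponent_coe] at hxi
  obtain ⟨y, hy, rfl⟩ := hxi
  exact hy

theorem wanderingSubspace_eq_jointWoldComponent (hT : ∀ i, T i ∈ boundedBelow ℂ H)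
    (hTT : Pairwise fun i j => DoublyTwisted (T i) (T j)) (A : Finset (Fin n)) :
    wanderingSubspace T A = jointWoldComponent T (woldIndex A 0) := by
  refine (wanderingSubspace_le_jointWoldComponent T A).antisymm (le_iInf fun l => ?_)
  calc jointWoldComponent T (woldIndex A 0)
      = imageSubspace (tuplePow T Aᶜ l) (jointWoldComponent T (woldIndex A 0)) := by
        rw [map_tuplePow_jointWoldComponent hT hTT, woldIndex_add_extend_compl]
    _ ≤ imageSubspace (tuplePow T Aᶜ l) (kernelSubspace T A) :=
        Submodule.map_mono (jointWoldComponent_le_kernelSubspace T A)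

theorem map_tuplePow_wanderingSubspace (hT : ∀ i, T i ∈ boundedBelow ℂ H)
    (hTT : Pairwise fun i j => DoublyTwisted (T i) (T j)) (k : A → ℕ) :
    imageSubspace (tuplePow T A k) (wanderingSubspace T A) =
      jointWoldComponent T (woldIndex A k) := by
  rw [wanderingSubspace_eq_jointWoldComponent hT hTT, map_tuplePow_jointWoldComponent hT hTT,
    woldIndex_add_extend, zero_add]

theorem apply_mem_map_tuplePow_add_single (hT : ∀ i, T i ∈ boundedBelow ℂ H)
    (hTT : Pairwise fun i j => DoublyTwisted (T i) (T j)) (k : A → ℕ) (i : A) {x : H}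
    (hx : x ∈ imageSubspace (tuplePow T A k) (wanderingSubspace T A)) :
    T i x ∈ imageSubspace (tuplePow T A (k + Pi.single i 1)) (wanderingSubspace T A) := by
  rw [map_tuplePow_wanderingSubspace hT hTT] at hx ⊢
  rw [← woldIndex_add_extend, ← map_tuplePow_jointWoldComponent hT hTT, tuplePow_single, pow_one]
  exact Submodule.mem_map_of_mem hx

theorem apply_mem_map_tuplePow_of_notMem (hT : ∀ i, T i ∈ boundedBelow ℂ H)
    (hTT : Pairwise fun i j => DoublyTwisted (T i) (T j)) (k : A → ℕ) {s : Fin n} (hs : s ∉ A)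
    {x : H} (hx : x ∈ imageSubspace (tuplePow T A k) (wanderingSubspace T A)) :
    T s x ∈ imageSubspace (tuplePow T A k) (wanderingSubspace T A) := by
  rw [map_tuplePow_wanderingSubspace hT hTT] at hx ⊢
  rw [← woldIndex_add_extend_compl k (Pi.single ⟨s, Finset.mem_compl.2 hs⟩ 1),
    ← map_tuplePow_jointWoldComponent hT hTT, tuplePow_single, pow_one]
  exact Submodule.mem_map_of_mem hx

theorem isClosed_wanderingSubspace (hT : ∀ i, T i ∈ boundedBelow ℂ H)
    (hTT : Pairwise fun i j => DoublyTwisted (T i) (T j)) (A : Finset (Fin n)) :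
    IsClosed (wanderingSubspace T A : Set H) := by
  rw [wanderingSubspace_eq_jointWoldComponent hT hTT]
  exact isClosed_jointWoldComponent hT _

theorem isOrtho_map_tuplePow_wanderingSubspace (hT : ∀ i, IsWoldOperator (T i))
    (hTT : Pairwise fun i j => DoublyTwisted (T i) (T j)) :
    Pairwise fun p q : Σ A : Finset (Fin n), A → ℕ =>
      imageSubspace (tuplePow T p.1 p.2) (wanderingSubspace T p.1) ⟂
        imageSubspace (tuplePow T q.1 q.2) (wanderingSubspace T q.1) := by
  intro p q h
  have hbdd (i : Fin n) := (hT i).mem_boundedBelow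
  rw [map_tuplePow_wanderingSubspace hbdd hTT, map_tuplePow_wanderingSubspace hbdd hTT]
  exact isOrtho_jointWoldComponent hT (woldIndex_bijective.injective.ne h)

theorem iInf_orthogonal_map_tuplePow_wanderingSubspace (hT : ∀ i, IsWoldOperator (T i))
    (hTT : Pairwise fun i j => DoublyTwisted (T i) (T j)) :
    ⨅ p : Σ A : Finset (Fin n), A → ℕ,
      (imageSubspace (tuplePow T p.1 p.2) (wanderingSubspace T p.1))ᗮ = ⊥ := by
  simp only [map_tuplePow_wanderingSubspace (fun i => (hT i).mem_boundedBelow) hTT]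
  rw [woldIndex_bijective.surjective.iInf_comp fun α => (jointWoldComponent T α)ᗮ]
  exact iInf_orthogonal_jointWoldComponent hT hTT

end TuplePow

section NearIsometry

variable {H : Type*} [NormedAddCommGroup H] [InnerProductSpace ℂ H] [CompleteSpace H]

theorem IsNearIsometry.isWoldOperator {T : H →L[ℂ] H} (hT : IsNearIsometry T) :
    IsWoldOperator T where
  mem_boundedBelow :=
    let ⟨_, hδ, h⟩ := hT.bounds
    mem_boundedBelow_of_bound hδ fun x => (h x).1
  adjoint_pow_pow_succ_mem_range := hT.range_le

theorem IsDoublyTwistedNearIsometry.pairwise_doublyTwisted {n : ℕ} {T : Fin n → H →L[ℂ] H}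
    {U : Fin n → Fin n → H →L[ℂ] H} (hT : IsDoublyTwistedNearIsometry T U) :
    Pairwise fun i j => DoublyTwisted (T i) (T j) := by
  have hlt {i j : Fin n} (h : i < j) : DoublyTwisted (T i) (T j) :=
    ⟨U i j, hT.unitary i j h, (hT.mul_unitary i j i h).symm, (hT.mul_unitary i j j h).symm,
      hT.mul_mul i j h, hT.adjoint_mul i j h⟩
  exact fun i j h => h.lt_or_gt.elim hlt fun h => (hlt h).symm

end NearIsometry

section Polar

open ContinuousLinearMap (adjoint)

theorem exists_isPositive_norm_apply_eq {E F : Type*} [NormedAddCommGroup E]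
    [InnerProductSpace ℂ E] [CompleteSpace E] [NormedAddCommGroup F] [InnerProductSpace ℂ F]
    [CompleteSpace F] (S : E →L[ℂ] F) : ∃ P : E →L[ℂ] E, P.IsPositive ∧ ∀ x, ‖P x‖ = ‖S x‖ := by
  have hQ : 0 ≤ adjoint S ∘L S :=
    (ContinuousLinearMap.nonneg_iff_isPositive _).2
      (ContinuousLinearMap.isPositive_adjoint_comp_self S)
  have hP : (CFC.sqrt (adjoint S ∘L S)).IsPositive :=
    (ContinuousLinearMap.nonneg_iff_isPositive _).1 (CFC.sqrt_nonneg _)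
  refine ⟨_, hP, fun x => ?_⟩
  set P := CFC.sqrt (adjoint S ∘L S)
  have hPP : adjoint P ∘L P = adjoint S ∘L S := by
    rw [hP.isSelfAdjoint.adjoint_eq]
    exact CFC.sqrt_mul_sqrt_self _ hQ
  rw [ContinuousLinearMap.apply_norm_eq_sqrt_inner_adjoint_left, hPP,
    ← ContinuousLinearMap.apply_norm_eq_sqrt_inner_adjoint_left]

theorem bijective_of_isSelfAdjoint_of_mem_boundedBelow {𝕜 E : Type*} [RCLike 𝕜]
    [NormedAddCommGroup E] [InnerProductSpace 𝕜 E] [CompleteSpace E] {P : E →L[𝕜] E}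
    (hP : IsSelfAdjoint P) (hbdd : P ∈ boundedBelow 𝕜 E) : Function.Bijective P := by
  refine P.bijective_iff_dense_range_and_antilipschitz.2 ⟨?_, hbdd⟩
  rw [Submodule.topologicalClosure_eq_top_iff, ContinuousLinearMap.orthogonal_range,
    hP.adjoint_eq, LinearMap.ker_eq_bot]
  exact injective_of_mem_boundedBelow hbdd

theorem exists_isPolarUnitary {H : Type*} [NormedAddCommGroup H] [InnerProductSpace ℂ H]
    [CompleteSpace H] {L : H →L[ℂ] H} (hL : L ∈ boundedBelow ℂ H) (D : Submodule ℂ H)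
    [CompleteSpace D] : ∃ Λ : D ≃ₗᵢ[ℂ] imageSubspace L D, IsPolarUnitary L D Λ := by
  obtain ⟨P, hP, hnorm⟩ := exists_isPositive_norm_apply_eq (L ∘L D.subtypeL)
  replace hnorm (x : D) : ‖P x‖ = ‖L x‖ := hnorm x
  have hbdd : P ∈ boundedBelow ℂ D := by
    obtain ⟨K, hK⟩ := hL
    refine ⟨K, P.antilipschitz_of_bound fun x => ?_⟩
    rw [hnorm]
    exact L.bound_of_antilipschitz hK x
  let e : D ≃ₗ[ℂ] D := .ofBijective (P : D →ₗ[ℂ] D)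
    (bijective_of_isSelfAdjoint_of_mem_boundedBelow hP.isSelfAdjoint hbdd)
  let f : D ≃ₗ[ℂ] imageSubspace L D :=
    D.equivMapOfInjective (L : H →ₗ[ℂ] H) (injective_of_mem_boundedBelow hL)
  refine ⟨⟨e.symm.trans f, fun x => ?_⟩, P, hP, fun x => ?_⟩
  · obtain ⟨y, rfl⟩ := e.surjective x
    rw [LinearEquiv.trans_apply, LinearEquiv.symm_apply_apply]
    exact (hnorm y).symm
  · change L x = f (e.symm (e x))
    rw [LinearEquiv.symm_apply_apply]
    rfl

end Polar

section HilbertSum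

variable {𝕜 α : Type*} [RCLike 𝕜] {G : α → Type*} [∀ a, NormedAddCommGroup (G a)]
  [∀ a, InnerProductSpace 𝕜 (G a)] {E E' F : Type*} [NormedAddCommGroup E] [InnerProductSpace 𝕜 E]
  [CompleteSpace E] [NormedAddCommGroup E'] [InnerProductSpace 𝕜 E'] [CompleteSpace E']
  [NormedAddCommGroup F] [NormedSpace 𝕜 F]

theorem isHilbertSum_of_forall_inner_eq_zero [∀ a, CompleteSpace (G a)] {V : ∀ a, G a →ₗᵢ[𝕜] E}
    (hV : OrthogonalFamily 𝕜 G V) (h : ∀ x, (∀ a y, ⟪V a y, x⟫_𝕜 = 0) → x = 0) :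
    IsHilbertSum 𝕜 G V := by
  refine .mk hV (top_le_iff.2 ?_)
  rw [Submodule.topologicalClosure_eq_top_iff, Submodule.eq_bot_iff]
  exact fun x hx => h x fun a y => hx _ (Submodule.mem_iSup_of_mem a ⟨y, rfl⟩)

theorem isHilbertSum_subtypeₗᵢ_comp [∀ a, CompleteSpace (G a)] {K : α → Submodule 𝕜 E}
    (hK : Pairwise fun a b => K a ⟂ K b) (hK' : ⨅ a, (K a)ᗮ = ⊥) (e : ∀ a, G a ≃ₗᵢ[𝕜] K a) :
    IsHilbertSum 𝕜 G fun a => (K a).subtypeₗᵢ.comp (e a).toLinearIsometry := by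
  refine isHilbertSum_of_forall_inner_eq_zero
    (fun a b hab x y => (hK hab).inner_eq (e a x).2 (e b y).2) fun x hx => ?_
  rw [← Submodule.mem_bot 𝕜, ← hK', Submodule.mem_iInf]
  intro a y hy
  simpa using hx a ((e a).symm ⟨y, hy⟩)

theorem exists_linearIsometryEquiv_of_isHilbertSum {V : ∀ a, G a →ₗᵢ[𝕜] E}
    {V' : ∀ a, G a →ₗᵢ[𝕜] E'} (hV : IsHilbertSum 𝕜 G V) (hV' : IsHilbertSum 𝕜 G V') :
    ∃ W : E ≃ₗᵢ[𝕜] E', ∀ a x, W (V a x) = V' a x := by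
  classical
  refine ⟨hV.linearIsometryEquiv.trans hV'.linearIsometryEquiv.symm, fun a x => ?_⟩
  rw [LinearIsometryEquiv.trans_apply, ← hV.linearIsometryEquiv_symm_apply_single,
    LinearIsometryEquiv.apply_symm_apply, hV'.linearIsometryEquiv_symm_apply_single]

theorem continuousLinearMap_ext_of_isHilbertSum {V : ∀ a, G a →ₗᵢ[𝕜] E}
    (hV : IsHilbertSum 𝕜 G V) {X Y : E →L[𝕜] F} (h : ∀ a x, X (V a x) = Y (V a x)) : X = Y := by
  ext x
  obtain ⟨f, rfl⟩ := hV.linearIsometryEquiv.symm.surjective x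
  have hf := hV.hasSum_linearIsometryEquiv_symm f
  refine (hf.mapL X).unique ?_
  simpa only [h] using hf.mapL Y

theorem eq_zero_of_isHilbertSum {V : ∀ a, G a →ₗᵢ[𝕜] E} (hV : IsHilbertSum 𝕜 G V) {x : E}
    (hx : ∀ a y, ⟪V a y, x⟫_𝕜 = 0) : x = 0 := by
  have h : innerSL 𝕜 x = 0 := continuousLinearMap_ext_of_isHilbertSum hV fun a y => by
    rw [innerSL_apply_apply, zero_apply, inner_eq_zero_symm, hx]
  exact inner_self_eq_zero.1 (DFunLike.congr_fun h x)

end HilbertSum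

section Hardy

variable {ι : Type*} [Fintype ι] {E : Type*} [NormedAddCommGroup E] [InnerProductSpace ℂ E]

theorem summable_norm_multiPow (z : Polydisc ι) : Summable fun k => ‖multiPow k z.1‖ := by
  classical
  refine summable_of_sum_le (c := ∏ i, ∑' j : ℕ, ‖z.1 i‖ ^ j) (fun _ => norm_nonneg _)
    fun s => ?_
  have hgeom (i : ι) : Summable fun j : ℕ => ‖z.1 i‖ ^ j :=
    summable_geometric_of_lt_one (norm_nonneg _) (z.2 i)
  calc ∑ k ∈ s, ‖multiPow k z.1‖
      ≤ ∑ k ∈ Fintype.piFinset fun i => s.image fun k => k i, ‖multiPow k z.1‖ :=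
        Finset.sum_le_sum_of_subset_of_nonneg
          (fun k hk => Fintype.mem_piFinset.2 fun i => Finset.mem_image_of_mem _ hk)
          fun _ _ _ => norm_nonneg _
    _ = ∏ i, ∑ j ∈ s.image fun k => k i, ‖z.1 i‖ ^ j := by
        simp only [Finset.prod_univ_sum, multiPow, norm_prod, norm_pow]
    _ ≤ ∏ i, ∑' j : ℕ, ‖z.1 i‖ ^ j :=
        Finset.prod_le_prod (fun i _ => Finset.sum_nonneg fun _ _ => by positivity)
          fun i _ => (hgeom i).sum_le_tsum _ fun _ _ => by positivity

namespace HardySpace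

theorem coeff_eq_of_hasSum {f : HardySpace ι E} {c : lp (fun _ : ι → ℕ => E) 2}
    (h : ∀ z : Polydisc ι, HasSum (fun k => multiPow k z.1 • c k) (f z)) : coeff f = c :=
  Subtype.ext <| coeff_unique f.hasSum_coeff h

theorem coeff_surjective [CompleteSpace E] :
    Function.Surjective (coeff : HardySpace ι E →ₗ[ℂ] lp (fun _ : ι → ℕ => E) 2) := by
  intro c
  have hs (z : Polydisc ι) : Summable fun k => multiPow k z.1 • c k := by
    refine .of_norm_bounded ((summable_norm_multiPow z).mul_right ‖c‖) fun k => ?_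
    rw [norm_smul]
    gcongr
    exact lp.norm_apply_le_norm two_ne_zero c k
  exact ⟨⟨fun z => ∑' k, multiPow k z.1 • c k, c, fun z => (hs z).hasSum⟩,
    coeff_eq_of_hasSum fun z => (hs z).hasSum⟩

/-- The identification of the Hardy space with the space of square summable coefficient
sequences. -/
noncomputable def coeffEquiv [CompleteSpace E] :
    HardySpace ι E ≃ₗᵢ[ℂ] lp (fun _ : ι → ℕ => E) 2 where
  toLinearEquiv := .ofBijective coeff ⟨coeff_injective, coeff_surjective⟩
  norm_map' _ := rfl

instance [CompleteSpace E] : CompleteSpace (HardySpace ι E) :=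
  (coeffEquiv (ι := ι) (E := E)).toIsometryEquiv.completeSpace

theorem coeff_monomial [DecidableEq (ι → ℕ)] (k : ι → ℕ) (η : E) :
    coeff (monomial k η : HardySpace ι E) = lp.single 2 k η := by
  refine coeff_eq_of_hasSum fun z => ?_
  change HasSum _ (multiPow k z.1 • η)
  convert hasSum_ite_eq k (multiPow k z.1 • η) using 2 with j
  split_ifs with h
  · rw [h, lp.single_apply_self]
  · rw [lp.single_apply_ne _ _ _ h, smul_zero]

theorem inner_monomial_left (k : ι → ℕ) (η : E) (f : HardySpace ι E) :
    ⟪monomial k η, f⟫_ℂ = ⟪η, coeff f k⟫_ℂ := by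
  classical
  change ⟪coeff (monomial k η), coeff f⟫_ℂ = _
  rw [coeff_monomial, lp.inner_single_left]

/-- The isometric embedding `η ↦ zᵏ ⊗ η`. -/
noncomputable def monomialₗᵢ (k : ι → ℕ) : E →ₗᵢ[ℂ] HardySpace ι E :=
  LinearMap.isometryOfInner
    { toFun := monomial k
      map_add' := fun _ _ => Subtype.ext (funext fun _ => smul_add _ _ _)
      map_smul' := fun _ _ => Subtype.ext (funext fun _ => smul_comm _ _ _) }
    fun η ξ => by
      classical
      change ⟪(monomial k η : HardySpace ι E), monomial k ξ⟫_ℂ = ⟪η, ξ⟫_ℂ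
      rw [inner_monomial_left, coeff_monomial, lp.single_apply_self]

theorem isHilbertSum_monomialₗᵢ [CompleteSpace E] :
    IsHilbertSum ℂ (fun _ => E) fun k : ι → ℕ => (monomialₗᵢ k : E →ₗᵢ[ℂ] HardySpace ι E) := by
  classical
  refine isHilbertSum_of_forall_inner_eq_zero (fun k l h η ξ => ?_) fun f hf => ?_
  · change ⟪(monomial k η : HardySpace ι E), monomial l ξ⟫_ℂ = 0
    rw [inner_monomial_left, coeff_monomial, lp.single_apply_ne _ _ _ h, inner_zero_right]
  · refine coeff_injective (lp.ext (funext fun k => ext_inner_left ℂ fun η => ?_))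
    rw [← inner_monomial_left, map_zero, lp.coeFn_zero, Pi.zero_apply, inner_zero_right]
    exact hf k η

end HardySpace

end Hardy

section DirectSum

variable {𝕜 α : Type*} [RCLike 𝕜] [Fintype α] [DecidableEq α] {G : α → Type*}
  [∀ a, NormedAddCommGroup (G a)] [∀ a, InnerProductSpace 𝕜 (G a)]

/-- The isometric inclusion of a summand in a finite Hilbert space direct sum. -/
noncomputable def piLpSingleₗᵢ (a : α) : G a →ₗᵢ[𝕜] PiLp 2 G where
  toFun := PiLp.single 2 a
  map_add' _ _ := PiLp.single_add 2 a
  map_smul' c x := PiLp.ext fun b => by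
    rcases eq_or_ne b a with rfl | h
    · simp
    · simp [PiLp.single_eq_of_ne 2 h]
  norm_map' x := by simp

theorem inner_piLp_single_left (a : α) (x : G a) (f : PiLp 2 G) :
    ⟪(PiLp.single 2 a x : PiLp 2 G), f⟫_𝕜 = ⟪x, f a⟫_𝕜 := by
  rw [PiLp.inner_apply, Finset.sum_eq_single a]
  · rw [PiLp.single_eq_same]
  · intro b _ hb
    rw [PiLp.single_eq_of_ne 2 hb, inner_zero_left]
  · exact fun h => absurd (Finset.mem_univ a) h

theorem isHilbertSum_piLpSingleₗᵢ_comp {κ : α → Type*} {D : (Σ a, κ a) → Type*}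
    [∀ p, NormedAddCommGroup (D p)] [∀ p, InnerProductSpace 𝕜 (D p)] [∀ p, CompleteSpace (D p)]
    [∀ a, CompleteSpace (G a)] {V : ∀ p : Σ a, κ a, D p →ₗᵢ[𝕜] G p.1}
    (hV : ∀ a, IsHilbertSum 𝕜 (fun k => D ⟨a, k⟩) fun k => V ⟨a, k⟩) :
    IsHilbertSum 𝕜 D fun p => (piLpSingleₗᵢ p.1 : G p.1 →ₗᵢ[𝕜] PiLp 2 G).comp (V p) := by
  refine isHilbertSum_of_forall_inner_eq_zero ?_ fun f hf => PiLp.ext fun a => ?_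
  · rintro ⟨a, k⟩ ⟨b, l⟩ h x y
    refine (inner_piLp_single_left a _ _).trans ?_
    change ⟪V ⟨a, k⟩ x, (PiLp.single 2 b (V ⟨b, l⟩ y) : PiLp 2 G) a⟫_𝕜 = 0
    rcases eq_or_ne a b with rfl | hab
    · rw [PiLp.single_eq_same]
      exact (hV a).OrthogonalFamily (fun hkl => h (congrArg (Sigma.mk a) hkl)) x y
    · rw [PiLp.single_eq_of_ne 2 hab, inner_zero_right]
  · exact eq_zero_of_isHilbertSum (hV a) fun k y =>
      (inner_piLp_single_left a _ f).symm.trans (hf ⟨a, k⟩ y)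

/-- The diagonal block of an operator on a finite Hilbert space direct sum, its compression to one
of the summands. -/
noncomputable def diagonalBlock (X : PiLp 2 G →L[𝕜] PiLp 2 G) (a : α) : G a →L[𝕜] G a :=
  PiLp.proj 2 G a ∘L X ∘L (piLpSingleₗᵢ a).toContinuousLinearMap

theorem diagonalBlock_apply (X : PiLp 2 G →L[𝕜] PiLp 2 G) (a : α) (x : G a) :
    diagonalBlock X a x = X (PiLp.single 2 a x) a :=
  rfl

end DirectSum

section Model

variable {α : Type*} [Fintype α] {G : α → Type*} [∀ a, NormedAddCommGroup (G a)]
  [∀ a, InnerProductSpace ℂ (G a)]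

theorem directSumOperator_single [DecidableEq α] (M : ∀ a, G a →L[ℂ] G a) (a : α) (x : G a) :
    directSumOperator M (PiLp.single 2 a x) = PiLp.single 2 a (M a x) := by
  ext b : 1
  change M b (PiLp.single 2 a x b) = _
  rcases eq_or_ne b a with rfl | h
  · rw [PiLp.single_eq_same, PiLp.single_eq_same]
  · rw [PiLp.single_eq_of_ne 2 h, PiLp.single_eq_of_ne 2 h, map_zero]

variable [∀ a, CompleteSpace (G a)] {κ : α → Type*} {D : (Σ a, κ a) → Type*}
  [∀ p, NormedAddCommGroup (D p)] [∀ p, InnerProductSpace ℂ (D p)] [∀ p, CompleteSpace (D p)]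
  {V : ∀ p : Σ a, κ a, D p →ₗᵢ[ℂ] G p.1}

theorem directSumOperator_diagonalBlock [DecidableEq α]
    (hV : ∀ a, IsHilbertSum ℂ (fun k => D ⟨a, k⟩) fun k => V ⟨a, k⟩) {X : PiLp 2 G →L[ℂ] PiLp 2 G}
    (hX : ∀ p x, ∃ y, X (PiLp.single 2 p.1 (V p x)) = PiLp.single 2 p.1 y) :
    directSumOperator (diagonalBlock X) = X := by
  refine continuousLinearMap_ext_of_isHilbertSum (isHilbertSum_piLpSingleₗᵢ_comp hV) fun p x => ?_
  change directSumOperator _ (PiLp.single 2 p.1 (V p x)) = X (PiLp.single 2 p.1 (V p x))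
  obtain ⟨y, hy⟩ := hX p x
  rw [directSumOperator_single, diagonalBlock_apply, hy, PiLp.single_eq_same]

theorem exists_tupleUnitarilyEquivalent_directSumOperator {H σ : Type*} [NormedAddCommGroup H]
    [InnerProductSpace ℂ H] [CompleteSpace H] {T : σ → H →L[ℂ] H}
    {V₀ : ∀ p : Σ a, κ a, D p →ₗᵢ[ℂ] H} (hV₀ : IsHilbertSum ℂ D V₀)
    (hV : ∀ a, IsHilbertSum ℂ (fun k => D ⟨a, k⟩) fun k => V ⟨a, k⟩)
    (hT : ∀ s a k x, ∃ l y, T s (V₀ ⟨a, k⟩ x) = V₀ ⟨a, l⟩ y) :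
    ∃ M : ∀ a, σ → G a →L[ℂ] G a,
      (∀ s a k l x y, T s (V₀ ⟨a, k⟩ x) = V₀ ⟨a, l⟩ y → M a s (V ⟨a, k⟩ x) = V ⟨a, l⟩ y) ∧
      TupleUnitarilyEquivalent T fun s => directSumOperator fun a => M a s := by
  classical
  obtain ⟨W, hW⟩ := exists_linearIsometryEquiv_of_isHilbertSum hV₀
    (isHilbertSum_piLpSingleₗᵢ_comp hV)
  replace hW (a : α) (k : κ a) (x : D ⟨a, k⟩) :
    W (V₀ ⟨a, k⟩ x) = PiLp.single 2 a (V ⟨a, k⟩ x) := hW ⟨a, k⟩ x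
  let X (s : σ) : PiLp 2 G →L[ℂ] PiLp 2 G := (W : H →L[ℂ] PiLp 2 G) ∘L T s ∘L (W.symm : _ →L[ℂ] H)
  have hX {s a k l x y} (h : T s (V₀ ⟨a, k⟩ x) = V₀ ⟨a, l⟩ y) :
      X s (PiLp.single 2 a (V ⟨a, k⟩ x)) = PiLp.single 2 a (V ⟨a, l⟩ y) := by
    change W (T s (W.symm _)) = _
    rw [← hW, ← hW, LinearIsometryEquiv.symm_apply_apply, h]
  refine ⟨fun a s => diagonalBlock (X s) a, fun s a k l x y h => ?_, W, fun s z => ?_⟩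
  · rw [diagonalBlock_apply, hX h, PiLp.single_eq_same]
  · have hdiag : directSumOperator (diagonalBlock (X s)) = X s := by
      refine directSumOperator_diagonalBlock hV fun ⟨a, k⟩ x => ?_
      obtain ⟨l, y, h⟩ := hT s a k x
      exact ⟨_, (hX h :)⟩
    exact DFunLike.congr_fun hdiag.symm z

end Model

theorem theorem1_general {H : Type*} [NormedAddCommGroup H] [InnerProductSpace ℂ H]
    [CompleteSpace H] {n : ℕ} (T : Fin n → H →L[ℂ] H) (hT : ∀ i, IsWoldOperator (T i))
    (hTT : Pairwise fun i j => DoublyTwisted (T i) (T j)) :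
    ∃ Λ : ∀ (A : Finset (Fin n)) (k : A → ℕ),
        wanderingSubspace T A ≃ₗᵢ[ℂ] imageSubspace (tuplePow T A k) (wanderingSubspace T A),
      (∀ A k, IsPolarUnitary (tuplePow T A k) (wanderingSubspace T A) (Λ A k)) ∧
      ∃ (hshift : ∀ (A : Finset (Fin n)) (k : A → ℕ) (i : A) (η : wanderingSubspace T A),
          T i (Λ A k η) ∈
            imageSubspace (tuplePow T A (k + Pi.single i 1)) (wanderingSubspace T A))
        (hdiag : ∀ (A : Finset (Fin n)) (k : A → ℕ) (s : Fin n), s ∉ A →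
          ∀ η : wanderingSubspace T A,
          T s (Λ A k η) ∈ imageSubspace (tuplePow T A k) (wanderingSubspace T A))
        (M : ∀ A : Finset (Fin n), Fin n →
          HardySpace A (wanderingSubspace T A) →L[ℂ] HardySpace A (wanderingSubspace T A)),
        (∀ (A : Finset (Fin n)) (k : A → ℕ) (i : A) (η : wanderingSubspace T A),
          M A i (HardySpace.monomial k η) =
            HardySpace.monomial (k + Pi.single i 1)
              ((Λ A (k + Pi.single i 1)).symm ⟨T i (Λ A k η), hshift A k i η⟩)) ∧
        (∀ (A : Finset (Fin n)) (k : A → ℕ) (s : Fin n) (hs : s ∉ A)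
          (η : wanderingSubspace T A),
          M A s (HardySpace.monomial k η) =
            HardySpace.monomial k ((Λ A k).symm ⟨T s (Λ A k η), hdiag A k s hs η⟩)) ∧
        TupleUnitarilyEquivalent T (fun s => directSumOperator fun A => M A s) := by
  have hbdd (i : Fin n) := (hT i).mem_boundedBelow
  have (A : Finset (Fin n)) : CompleteSpace (wanderingSubspace T A) :=
    (isClosed_wanderingSubspace hbdd hTT A).completeSpace_coe
  choose Λ hΛ using fun (A : Finset (Fin n)) (k : A → ℕ) =>
    exists_isPolarUnitary (tuplePow_mem_boundedBelow hbdd k) (wanderingSubspace T A)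
  have hshift (A : Finset (Fin n)) (k : A → ℕ) (i : A) (η : wanderingSubspace T A) :=
    apply_mem_map_tuplePow_add_single hbdd hTT k i (Λ A k η).2
  have hdiag (A : Finset (Fin n)) (k : A → ℕ) (s : Fin n) (hs : s ∉ A)
      (η : wanderingSubspace T A) := apply_mem_map_tuplePow_of_notMem hbdd hTT k hs (Λ A k η).2
  have happly {A : Finset (Fin n)} {k : A → ℕ} {x : H}
      (hx : x ∈ imageSubspace (tuplePow T A k) (wanderingSubspace T A)) :
      x = Λ A k ((Λ A k).symm ⟨x, hx⟩) := by
    rw [LinearIsometryEquiv.apply_symm_apply]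
  obtain ⟨M, hM, hequiv⟩ := exists_tupleUnitarilyEquivalent_directSumOperator (T := T)
    (G := fun A : Finset (Fin n) => HardySpace A (wanderingSubspace T A))
    (V := fun p => HardySpace.monomialₗᵢ p.2)
    (isHilbertSum_subtypeₗᵢ_comp (isOrtho_map_tuplePow_wanderingSubspace hT hTT)
      (iInf_orthogonal_map_tuplePow_wanderingSubspace hT hTT) fun p => Λ p.1 p.2)
    (fun A => HardySpace.isHilbertSum_monomialₗᵢ (E := wanderingSubspace T A)) fun s A k η => by
      by_cases hs : s ∈ A
      · exact ⟨_, _, happly (hshift A k ⟨s, hs⟩ η)⟩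
      · exact ⟨_, _, happly (hdiag A k s hs η)⟩
  exact ⟨Λ, hΛ, hshift, hdiag, M,
    fun A k i η => hM i A k _ η _ (happly (hshift A k i η)),
    fun A k s hs η => hM s A k k η _ (happly (hdiag A k s hs η)), hequiv⟩

theorem theorem1 {H : Type*} [NormedAddCommGroup H] [InnerProductSpace ℂ H] [CompleteSpace H]
    {n : ℕ} (T : Fin n → H →L[ℂ] H) (U : Fin n → Fin n → H →L[ℂ] H)
    (hT : IsDoublyTwistedNearIsometry T U) :
    ∃ Λ : ∀ (A : Finset (Fin n)) (k : A → ℕ),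
        wanderingSubspace T A ≃ₗᵢ[ℂ] imageSubspace (tuplePow T A k) (wanderingSubspace T A),
      (∀ A k, IsPolarUnitary (tuplePow T A k) (wanderingSubspace T A) (Λ A k)) ∧
      ∃ (hshift : ∀ (A : Finset (Fin n)) (k : A → ℕ) (i : A) (η : wanderingSubspace T A),
          T i (Λ A k η) ∈
            imageSubspace (tuplePow T A (k + Pi.single i 1)) (wanderingSubspace T A))
        (hdiag : ∀ (A : Finset (Fin n)) (k : A → ℕ) (s : Fin n), s ∉ A →
          ∀ η : wanderingSubspace T A,
          T s (Λ A k η) ∈ imageSubspace (tuplePow T A k) (wanderingSubspace T A))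
        (M : ∀ A : Finset (Fin n), Fin n →
          HardySpace A (wanderingSubspace T A) →L[ℂ] HardySpace A (wanderingSubspace T A)),
        (∀ (A : Finset (Fin n)) (k : A → ℕ) (i : A) (η : wanderingSubspace T A),
          M A i (HardySpace.monomial k η) =
            HardySpace.monomial (k + Pi.single i 1)
              ((Λ A (k + Pi.single i 1)).symm ⟨T i (Λ A k η), hshift A k i η⟩)) ∧
        (∀ (A : Finset (Fin n)) (k : A → ℕ) (s : Fin n) (hs : s ∉ A)
          (η : wanderingSubspace T A),
          M A s (HardySpace.monomial k η) =
            HardySpace.monomial k ((Λ A k).symm ⟨T s (Λ A k η), hdiag A k s hs η⟩)) ∧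
        TupleUnitarilyEquivalent T (fun s => directSumOperator fun A => M A s) := by
  exact theorem1_general T (fun i => (hT.nearIsometry i).isWoldOperator) hT.pairwise_doublyTwisted
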